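/- Let $(\Omega,\mathcal F,\mathbb P)$ be a probability space, let $\theta:\Omega\to\Omega$ be an invertible (with measurable inverse), measure-preserving, ergodic transformation, let $\mathbb M_d$ be the algebra of complex $d\times d$ matrices, and let $\phi:\omega\mapsto\phi_\omega$ be a random quantum channel, i.e. a measurable map from $\Omega$ to the completely positive, trace-preserving linear maps $\mathbb M_d\to\mathbb M_d$. Put $\phi_{n;\omega}=\phi_{\theta^n(\omega)}$, $\Phi_N=\phi_N\circ\cdots\circ\phi_1$ for $N\ge 1$, and, for a random matrix $X:\Omega\to\mathbb M_d$, let $\mathfrak L(X)_\omega=\phi_\omega(X_{\theta^{-1}(\omega)})$ (the transfer operator). Inequalities between matrices are in the sense of the positive semidefinite order, and random matrices that agree almost surely are identified. A random projection is a random matrix $P$ with $P=P^*=P^2$ almost surely. It is called reducing if there is a (possibly random) constant $C>0$ such that, for every $N\ge 1$, $\Phi_N(P)\le C\,(P\circ\theta^N)$ almost surely. A minimal reducing projection is a minimal element, with respect to almost sure inequality, of the set of those reducing random projections $P$ that are nonzero, i.e. satisfy $\mathbb P(P\ne 0)>0$. Let $\mathfrak A_*$ be the space of random matrices $X$ with $\mathbb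 E\,\mathrm{Tr}|X|<\infty$, and, for a random projection $P$, let $P\mathfrak A_*P$ be the set of $X\in\mathfrak A_*$ with $PXP=X$ almost surely. Let $P$ be a minimal reducing projection, and let $X\in P\mathfrak A_*P$ satisfy $X=X^*$ and $\mathfrak L(X)=X$ almost surely. Then either $\mathbb P(X\ge 0)=1$ or $\mathbb P(-X\ge 0)=1$. -/

import Mathlib

open MeasureTheory
open scoped ComplexOrder MatrixOrder Matrix.Norms.L2Operator CStarAlgebra

noncomputable section

namespace ERIS

/-- The C*-algebra of complex `d × d` matrices. Its order is the Loewner order: `A ≤ B` means that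
`B - A` is positive semidefinite. -/
abbrev Mat (d : ℕ) : Type := Matrix (Fin d) (Fin d) ℂ

/-- The trace norm `Tr |A|`, where `|A| = √(A* A)`. -/
def traceNorm {d : ℕ} (A : Mat d) : ℝ := (Matrix.trace (CFC.abs A)).re

/-- A quantum channel: a completely positive and trace-preserving linear map. -/
structure QuantumChannel (d : ℕ) extends Mat d →CP Mat d where
  trace_map' : ∀ A : Mat d, Matrix.trace (toLinearMap A) = Matrix.trace A

instance (d : ℕ) : CoeFun (QuantumChannel d) (fun _ => Mat d → Mat d) :=
  ⟨fun ψ => ψ.toLinearMap⟩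

variable {Ω : Type*} [MeasurableSpace Ω] {d : ℕ}

/-- A random matrix: measurability is measurability of all entries. -/
def IsRandomMatrix (X : Ω → Mat d) : Prop :=
  ∀ i j, Measurable fun ω => X ω i j

/-- A random quantum channel: `ω ↦ φ_ω(A)` is measurable for every fixed matrix `A`, that is, all
matrix coefficients of `φ` are measurable. -/
def IsRandomChannel (φ : Ω → QuantumChannel d) : Prop :=
  ∀ A : Mat d, IsRandomMatrix fun ω => φ ω A

/-- A random projection: `P = P* = P²` almost surely. -/
def IsRandomProjection (μ : Measure Ω) (P : Ω → Mat d) : Prop :=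
  IsRandomMatrix P ∧ ∀ᵐ ω ∂μ, IsStarProjection (P ω)

/-- For `N ≥ 1` and `φ_{n;ω} = φ_{θⁿ ω}`, this is `Φ_{N;ω} = φ_{N;ω} ∘ ⋯ ∘ φ_{1;ω}`
(the empty composition for `N = 0`). -/
def forward (θ : Ω ≃ᵐ Ω) (φ : Ω → QuantumChannel d) : ℕ → Ω → Mat d → Mat d
  | 0, _, A => A
  | N + 1, ω, A => φ (θ^[N + 1] ω) (forward θ φ N ω A)

/-- The transfer operator `𝔏(X)_ω = φ_ω(X_{θ⁻¹ ω})`. -/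
def transfer (θ : Ω ≃ᵐ Ω) (φ : Ω → QuantumChannel d) (X : Ω → Mat d) : Ω → Mat d :=
  fun ω => φ ω (X (θ.symm ω))

/-- The random projection `P` reduces the system: for some random constant `C > 0` and all
`N ≥ 1`, `Φ_N(P) ≤ C (P ∘ θ^N)` almost surely. -/
def Reduces (μ : Measure Ω) (θ : Ω ≃ᵐ Ω) (φ : Ω → QuantumChannel d) (P : Ω → Mat d) : Prop :=
  ∃ C : Ω → ℝ, Measurable C ∧ (∀ᵐ ω ∂μ, 0 < C ω) ∧
    ∀ N : ℕ, 1 ≤ N → ∀ᵐ ω ∂μ, forward θ φ N ω (P ω) ≤ C ω • P (θ^[N] ω)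

/-- The nonzero reducing random projections; nonzero means nonzero with positive probability. -/
def IsNonzeroReducing (μ : Measure Ω) (θ : Ω ≃ᵐ Ω) (φ : Ω → QuantumChannel d)
    (P : Ω → Mat d) : Prop :=
  IsRandomProjection μ P ∧ Reduces μ θ φ P ∧ ¬ ∀ᵐ ω ∂μ, P ω = 0

/-- Minimal elements of the set of nonzero reducing random projections, ordered by almost sure
inequality; random matrices are identified when they agree almost surely. -/
def IsMinimalReducing (μ : Measure Ω) (θ : Ω ≃ᵐ Ω) (φ : Ω → QuantumChannel d)
    (P : Ω → Mat d) : Prop :=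
  IsNonzeroReducing μ θ φ P ∧
    ∀ Q : Ω → Mat d, IsNonzeroReducing μ θ φ Q → (∀ᵐ ω ∂μ, Q ω ≤ P ω) → ∀ᵐ ω ∂μ, Q ω = P ω

/-- Membership in `𝔄_*`: random matrices whose trace norm is integrable. -/
def MemPredual (μ : Measure Ω) (X : Ω → Mat d) : Prop :=
  IsRandomMatrix X ∧ Integrable (fun ω => traceNorm (X ω)) μ

/-- Membership in the corner `P 𝔄_* P`: elements `X` of `𝔄_*` with `P X P = X` almost surely. -/
def MemCornerPredual (μ : Measure Ω) (P X : Ω → Mat d) : Prop :=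
  MemPredual μ X ∧ ∀ᵐ ω ∂μ, P ω * X ω * P ω = X ω

end ERIS

end

noncomputable section

namespace ERIS

variable {Ω : Type*} [MeasurableSpace Ω] {d : ℕ}

/-! Positivity and trace preservation give `Tr X⁺ ≤ Tr 𝔏(X⁺)` almost surely. Since `θ` preserves
`μ`, both sides have the same integral, so equality holds, and this forces `𝔏(X⁺) = X⁺`
(`transfer_pos_eq`). The support projection of `X⁺` is comparable with `X⁺` and the trace of `X⁺` is
constant along orbits, so that projection is reducing (`reduces_posProj`). It lies below `P`, so
minimality makes it `0` or `P`. The same holds for `-X`, and the two orthogonal supports cannot both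
equal `P ≠ 0`. -/

/-! ### Measurability of the functional calculus -/

/-- A continuous function of a random matrix is measurable. -/
theorem IsRandomMatrix.measurable_comp {E : Type*} [TopologicalSpace E] [MeasurableSpace E]
    [BorelSpace E] {X : Ω → Mat d} (hX : IsRandomMatrix X) {F : Mat d → E} (hF : Continuous F) :
    Measurable fun ω => F (X ω) := by
  have h : Measurable fun ω i j => X ω i j :=
    measurable_pi_iff.2 fun i => measurable_pi_iff.2 fun j => hX i j
  have hF' : Continuous (fun B : Fin d → Fin d → ℂ => F (Matrix.of B)) := hF
  exact hF'.measurable.comp h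

theorem continuousOn_spectrum (A : Mat d) (f : ℝ → ℝ) : ContinuousOn f (spectrum ℝ A) :=
  (Matrix.finite_real_spectrum (A := A)).continuousOn f

/-- Symmetrizing makes the argument self-adjoint for every matrix, which gives continuity on the
whole space. -/
theorem continuous_cfc_symmetrize {f : ℝ → ℝ} (hf : Continuous f) :
    Continuous fun A : Mat d => cfc f ((2⁻¹ : ℝ) • (A + star A)) := by
  refine Continuous.cfc_of_mem_nhdsSet (s := Set.univ) f Filter.univ_mem (by fun_prop)
    (fun A => ?_) hf.continuousOn
  exact (IsSelfAdjoint.all (2⁻¹ : ℝ)).smul (IsSelfAdjoint.add_star_self A)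

theorem symmetrize_of_isSelfAdjoint {A : Mat d} (hA : IsSelfAdjoint A) :
    (2⁻¹ : ℝ) • (A + star A) = A := by
  rw [hA.star_eq, ← two_smul ℝ A, smul_smul]
  norm_num

/-- The functional calculus by a pointwise limit of continuous functions preserves
random matrices. -/
theorem IsRandomMatrix.cfc_of_tendsto {X : Ω → Mat d} (hX : IsRandomMatrix X)
    (hsa : ∀ ω, IsSelfAdjoint (X ω)) {f : ℝ → ℝ} {F : ℕ → ℝ → ℝ} (hF : ∀ n, Continuous (F n))
    (hlim : ∀ x, Filter.Tendsto (fun n => F n x) Filter.atTop (nhds (f x))) :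
    IsRandomMatrix fun ω => cfc f (X ω) := by
  have hn (n : ℕ) : IsRandomMatrix fun ω => cfc (F n) (X ω) := fun i j => by
    have := hX.measurable_comp
      (F := fun A : Mat d => cfc (F n) ((2⁻¹ : ℝ) • (A + star A)) i j)
      ((continuous_cfc_symmetrize (hF n)).matrix_elem i j)
    simpa only [symmetrize_of_isSelfAdjoint (hsa _)] using this
  intro i j
  refine measurable_of_tendsto_metrizable (fun n => hn n i j) (tendsto_pi_nhds.2 fun ω => ?_)
  have ht : Filter.Tendsto (fun n => cfc (F n) (X ω)) Filter.atTop (nhds (cfc f (X ω))) := by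
    refine tendsto_cfc_fun ?_ (Filter.Eventually.of_forall fun n => (hF n).continuousOn)
    -- On a finite spectrum, pointwise convergence is uniform.
    rw [Metric.tendstoUniformlyOn_iff]
    intro ε hε
    exact ((Matrix.finite_real_spectrum (A := X ω)).eventually_all).2 fun x _ =>
      by simpa only [dist_comm] using (Metric.tendsto_nhds.1 (hlim x) ε hε)
  exact (((continuous_id (X := Mat d)).matrix_elem i j).tendsto _).comp ht

/-- The indicator function of the positive half-line. -/
def posIndicator (x : ℝ) : ℝ := if 0 < x then 1 else 0

/-- The reciprocal on the positive half-line, extended by zero. -/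
def posInv (x : ℝ) : ℝ := if 0 < x then x⁻¹ else 0

theorem tendsto_posIndicator (x : ℝ) :
    Filter.Tendsto (fun n : ℕ => x⁺ / (x⁺ + 1 / ((n : ℝ) + 1))) Filter.atTop
      (nhds (posIndicator x)) := by
  unfold posIndicator
  split_ifs with h
  · rw [posPart_eq_self.2 h.le]
    have := (tendsto_one_div_add_atTop_nhds_zero_nat (𝕜 := ℝ)).const_add x
    have := (tendsto_const_nhds (x := x)).div this (by simpa using h.ne')
    rwa [add_zero, div_self h.ne'] at this
  · rw [posPart_eq_zero.2 (not_lt.1 h)]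
    simp

theorem tendsto_posInv (x : ℝ) :
    Filter.Tendsto (fun n : ℕ => x⁺ / (x⁺ ^ 2 + 1 / ((n : ℝ) + 1))) Filter.atTop
      (nhds (posInv x)) := by
  unfold posInv
  split_ifs with h
  · rw [posPart_eq_self.2 h.le]
    have := (tendsto_one_div_add_atTop_nhds_zero_nat (𝕜 := ℝ)).const_add (x ^ 2)
    have := (tendsto_const_nhds (x := x)).div this (by simpa using h.ne')
    have hx : x / (x ^ 2 + 0) = x⁻¹ := by field_simp; simp
    rwa [hx] at this
  · rw [posPart_eq_zero.2 (not_lt.1 h)]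
    simp

/-- The spectral projection of a Hermitian matrix onto its positive eigenvalues. -/
def posProj (A : Mat d) : Mat d := cfc posIndicator A

/-- The pseudo-inverse of the positive part of a Hermitian matrix. -/
def posPinv (A : Mat d) : Mat d := cfc posInv A

/-- The positive part of a Hermitian matrix. -/
def pos (A : Mat d) : Mat d := cfc (fun x : ℝ => x⁺) A

theorem continuous_posPart_real : Continuous fun x : ℝ => x⁺ :=
  continuous_id.sup continuous_const

theorem IsRandomMatrix.pos {X : Ω → Mat d} (hX : IsRandomMatrix X)
    (hsa : ∀ ω, IsSelfAdjoint (X ω)) : IsRandomMatrix fun ω => pos (X ω) :=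
  hX.cfc_of_tendsto hsa (F := fun _ x => x⁺) (fun _ => continuous_posPart_real)
    fun _ => tendsto_const_nhds

theorem IsRandomMatrix.posProj {X : Ω → Mat d} (hX : IsRandomMatrix X)
    (hsa : ∀ ω, IsSelfAdjoint (X ω)) : IsRandomMatrix fun ω => posProj (X ω) :=
  hX.cfc_of_tendsto hsa (fun n => continuous_posPart_real.div
    (continuous_posPart_real.add continuous_const)
    fun x => (add_pos_of_nonneg_of_pos (posPart_nonneg x) (by positivity)).ne')
    tendsto_posIndicator

theorem IsRandomMatrix.posPinv {X : Ω → Mat d} (hX : IsRandomMatrix X)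
    (hsa : ∀ ω, IsSelfAdjoint (X ω)) : IsRandomMatrix fun ω => posPinv (X ω) :=
  hX.cfc_of_tendsto hsa (fun n => continuous_posPart_real.div
    ((continuous_posPart_real.pow 2).add continuous_const)
    fun x => (add_pos_of_nonneg_of_pos (sq_nonneg _) (by positivity)).ne')
    tendsto_posInv

/-! ### Positive parts and traces of a single matrix -/

section Pointwise

variable {A : Mat d}

theorem pos_nonneg (A : Mat d) : 0 ≤ pos A := cfc_nonneg fun x _ => posPart_nonneg x

theorem posProj_isStarProjection (A : Mat d) : IsStarProjection (posProj A) := by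
  refine ⟨?_, cfc_predicate _ A⟩
  unfold posProj
  rw [IsIdempotentElem, ← cfc_mul _ _ A (continuousOn_spectrum _ _) (continuousOn_spectrum _ _)]
  congr 1
  ext x
  simp [posIndicator]

theorem posProj_mul (hA : IsSelfAdjoint A) : posProj A * A = pos A := by
  unfold posProj pos
  nth_rw 2 [← cfc_id ℝ A]
  rw [← cfc_mul _ _ A (continuousOn_spectrum _ _) (continuousOn_spectrum _ _)]
  congr 1
  ext x
  by_cases h : 0 < x
  · simp [posIndicator, h, posPart_eq_self.2 h.le]
  · simp [posIndicator, h, posPart_eq_zero.2 (not_lt.1 h)]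

/-- Used to see that a projection fixing `A` from the left also fixes `posProj A`. -/
theorem mul_posPinv (hA : IsSelfAdjoint A) : A * posPinv A = posProj A := by
  unfold posProj posPinv
  nth_rw 1 [← cfc_id ℝ A]
  rw [← cfc_mul _ _ A (continuousOn_spectrum _ _) (continuousOn_spectrum _ _)]
  congr 1
  ext x
  by_cases h : 0 < x
  · simp [posIndicator, posInv, h, h.ne']
  · simp [posIndicator, posInv, h]

theorem posProj_mul_posProj_neg (hA : IsSelfAdjoint A) : posProj A * posProj (-A) = 0 := by
  unfold posProj
  rw [← cfc_comp_neg _ A ((Set.Finite.image _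
      (Matrix.finite_real_spectrum (A := A))).continuousOn _),
    ← cfc_mul _ _ A (continuousOn_spectrum _ _) (continuousOn_spectrum _ _)]
  rw [← cfc_zero ℝ A]
  congr 1
  ext x
  by_cases h : 0 < x
  · simp [posIndicator, h, h.le]
  · simp [posIndicator, h]

theorem le_pos (hA : IsSelfAdjoint A) : A ≤ pos A := by
  nth_rw 1 [← cfc_id' ℝ A]
  exact cfc_mono (fun x _ => le_posPart x) (continuousOn_spectrum _ _) (continuousOn_spectrum _ _)

theorem neg_nonneg_of_posProj_eq_zero (hA : IsSelfAdjoint A) (h : posProj A = 0) : 0 ≤ -A := by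
  have hle := le_pos hA
  rw [← posProj_mul hA, h, zero_mul] at hle
  exact neg_nonneg.2 hle

theorem pos_le_abs (hA : IsSelfAdjoint A) : pos A ≤ CFC.abs A := by
  rw [CFC.abs_eq_cfc_norm A hA]
  exact cfc_mono (fun x _ => sup_le (le_abs_self x) (abs_nonneg x))
    (continuousOn_spectrum _ _) (continuousOn_spectrum _ _)

/-- The norm bounds the reciprocal of every positive eigenvalue. -/
theorem posProj_le (hA : IsSelfAdjoint A) : posProj A ≤ ‖posPinv A‖ • pos A := by
  unfold posProj pos
  rw [← cfc_smul _ _ A (continuousOn_spectrum _ _)]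
  refine cfc_mono (fun x hx => ?_) (continuousOn_spectrum _ _) (continuousOn_spectrum _ _)
  by_cases h : 0 < x
  · have hn := norm_apply_le_norm_cfc posInv A hx (continuousOn_spectrum _ _) hA
    have hn' : x⁻¹ ≤ ‖posPinv A‖ := by
      simpa [posPinv, posInv, h, abs_of_pos h] using hn
    simpa [posIndicator, h, posPart_eq_self.2 h.le, h.ne'] using
      mul_le_mul_of_nonneg_right hn' h.le
  · simp [posIndicator, h, posPart_eq_zero.2 (not_lt.1 h)]

theorem le_trace_of_mem_spectrum {B : Mat d} (hB : 0 ≤ B) {x : ℝ} (hx : x ∈ spectrum ℝ B) :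
    x ≤ B.trace.re := by
  have hB' : B.PosSemidef := Matrix.nonneg_iff_posSemidef.1 hB
  rw [hB'.isHermitian.spectrum_real_eq_range_eigenvalues] at hx
  obtain ⟨i, rfl⟩ := hx
  rw [hB'.isHermitian.trace_eq_sum_eigenvalues, Complex.re_sum]
  exact Finset.single_le_sum (f := fun i => hB'.isHermitian.eigenvalues i)
    (fun j _ => hB'.eigenvalues_nonneg j) (Finset.mem_univ i)

/-- The trace dominates each eigenvalue of the positive part; unlike the norm, it is conserved by
channels. -/
theorem pos_le (hA : IsSelfAdjoint A) : pos A ≤ (pos A).trace.re • posProj A := by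
  have hspec : ∀ x ∈ spectrum ℝ A, x⁺ ≤ (pos A).trace.re := fun x hx =>
    le_trace_of_mem_spectrum (pos_nonneg A) <| by
      unfold pos
      rw [cfc_map_spectrum _ A hA (continuousOn_spectrum _ _)]
      exact ⟨x, hx, rfl⟩
  nth_rw 1 [pos]
  rw [posProj, ← cfc_smul _ _ A (continuousOn_spectrum _ _)]
  refine cfc_mono (fun x hx => ?_) (continuousOn_spectrum _ _) (continuousOn_spectrum _ _)
  by_cases h : 0 < x
  · simpa [posIndicator, h] using hspec x hx
  · simp [posIndicator, h, posPart_eq_zero.2 (not_lt.1 h)]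

theorem trace_re_mono {B C : Mat d} (h : B ≤ C) : B.trace.re ≤ C.trace.re := by
  have := (Matrix.le_iff.1 h).trace_nonneg
  rw [Matrix.trace_sub] at this
  simpa using (Complex.le_def.1 this).1

theorem trace_re_nonneg {B : Mat d} (h : 0 ≤ B) : 0 ≤ B.trace.re := by
  simpa using trace_re_mono h

theorem trace_projection_mul {Q B : Mat d} (hQ : IsStarProjection Q) :
    (Q * B).trace = (Q * B * star Q).trace := by
  rw [Matrix.trace_mul_comm (Q * B), ← mul_assoc, hQ.isSelfAdjoint.star_eq,
    hQ.isIdempotentElem.eq]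

theorem trace_projection_mul_nonneg {Q B : Mat d} (hQ : IsStarProjection Q) (hB : 0 ≤ B) :
    0 ≤ (Q * B).trace.re := by
  rw [trace_projection_mul hQ]
  exact trace_re_nonneg (star_right_conjugate_nonneg hB Q)

/-- `QBQ*` is positive with zero trace, hence zero; writing `B = S*S` turns this into `SQ* = 0`. -/
theorem projection_mul_eq_zero {Q B : Mat d} (hQ : IsStarProjection Q) (hB : 0 ≤ B)
    (h : (Q * B).trace.re = 0) : Q * B = 0 := by
  have hps : 0 ≤ Q * B * star Q := star_right_conjugate_nonneg hB Q
  have htr : (Q * B * star Q).trace = 0 := by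
    have h0 := (Matrix.nonneg_iff_posSemidef.1 hps).trace_nonneg
    refine Complex.ext ?_ (Complex.le_def.1 h0).2.symm
    rw [← trace_projection_mul hQ, h, Complex.zero_re]
  have hz : Q * B * star Q = 0 := (Matrix.nonneg_iff_posSemidef.1 hps).trace_eq_zero_iff.1 htr
  obtain ⟨S, rfl⟩ := CStarAlgebra.nonneg_iff_eq_star_mul_self.1 hB
  have : S * star Q = 0 := by
    rw [← CStarRing.star_mul_self_eq_zero_iff]
    simpa [mul_assoc] using hz
  have h2 : Q * star S = 0 := by simpa using congrArg star this
  rw [← mul_assoc, h2, zero_mul]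

/-- For `A = B - D` with `B, D ≥ 0`, the excess of `Tr B` over `Tr A⁺`. -/
theorem trace_pos_add {B D : Mat d} (hB : 0 ≤ B) (hD : 0 ≤ D) (hA : A = B - D) :
    (pos A).trace.re + (posProj A * D).trace.re + ((1 - posProj A) * B).trace.re
      = B.trace.re := by
  have hsa : IsSelfAdjoint A := hA ▸ (IsSelfAdjoint.of_nonneg hB).sub (IsSelfAdjoint.of_nonneg hD)
  rw [← posProj_mul hsa]
  nth_rw 2 [hA]
  rw [mul_sub, sub_mul, one_mul, Matrix.trace_sub, Matrix.trace_sub]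
  simp

/-- If `A = B - D` with `B, D ≥ 0` and `Tr A⁺ = Tr B`, then `A⁺ = B`. -/
theorem pos_eq_of_trace_eq {B D : Mat d} (hB : 0 ≤ B) (hD : 0 ≤ D) (hA : A = B - D)
    (h : (pos A).trace.re = B.trace.re) : pos A = B := by
  have hsa : IsSelfAdjoint A := hA ▸ (IsSelfAdjoint.of_nonneg hB).sub (IsSelfAdjoint.of_nonneg hD)
  have hsum := trace_pos_add hB hD hA
  have hQ := posProj_isStarProjection A
  have h1 := trace_projection_mul_nonneg hQ hD
  have h2 := trace_projection_mul_nonneg hQ.one_sub hB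
  -- Both nonnegative defects in `trace_pos_add` vanish, so the projection kills `D` and fixes `B`.
  have h3 := projection_mul_eq_zero hQ hD (by linarith)
  have h4 := projection_mul_eq_zero hQ.one_sub hB (by linarith)
  rw [sub_mul, one_mul, sub_eq_zero] at h4
  rw [← posProj_mul hsa]
  nth_rw 2 [hA]
  rw [mul_sub, h3, sub_zero, ← h4]

end Pointwise

end ERIS

end

/-! ### Fixed points of the transfer operator -/

namespace ERIS

variable {Ω : Type*} [MeasurableSpace Ω] {d : ℕ} {μ : Measure Ω} {θ : Ω ≃ᵐ Ω}
  {φ : Ω → QuantumChannel d} {X P : Ω → Mat d}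

theorem QuantumChannel.mono (ψ : QuantumChannel d) {A B : Mat d} (h : A ≤ B) : ψ A ≤ ψ B :=
  OrderHomClass.mono ψ.toCompletelyPositiveMap h

theorem QuantumChannel.map_nonneg (ψ : QuantumChannel d) {A : Mat d} (h : 0 ≤ A) : 0 ≤ ψ A := by
  simpa using ψ.mono h

theorem forward_mono (N : ℕ) (ω : Ω) {A B : Mat d} (h : A ≤ B) :
    forward θ φ N ω A ≤ forward θ φ N ω B := by
  induction N with
  | zero => exact h
  | succ N ih => exact (φ _).mono ih

theorem forward_smul (N : ℕ) (ω : Ω) (c : ℝ) (A : Mat d) :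
    forward θ φ N ω (c • A) = c • forward θ φ N ω A := by
  induction N with
  | zero => rfl
  | succ N ih => simp only [forward, ih, LinearMap.map_smul_of_tower]

theorem trace_forward (N : ℕ) (ω : Ω) (A : Mat d) :
    (forward θ φ N ω A).trace = A.trace := by
  induction N with
  | zero => rfl
  | succ N ih => rw [forward, (φ _).trace_map', ih]

/-- A fixed point of the transfer operator is carried along itself by the cocycle. -/
theorem forward_eq_of_transfer_eq (hθ : MeasurePreserving θ μ μ)
    (hfix : ∀ᵐ ω ∂μ, transfer θ φ X ω = X ω) :
    ∀ᵐ ω ∂μ, ∀ N : ℕ, forward θ φ N ω (X ω) = X (θ^[N] ω) := by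
  have h : ∀ᵐ ω ∂μ, ∀ N : ℕ, transfer θ φ X (θ^[N] ω) = X (θ^[N] ω) :=
    ae_all_iff.2 fun N => (hθ.iterate N).quasiMeasurePreserving.ae hfix
  filter_upwards [h] with ω hω N
  induction N with
  | zero => rfl
  | succ N ih =>
    rw [forward, ih, ← hω (N + 1), transfer, Function.iterate_succ_apply']
    simp

theorem integrable_trace_pos (hX : MemPredual μ X) (hsa : ∀ ω, IsSelfAdjoint (X ω)) :
    Integrable (fun ω => (pos (X ω)).trace.re) μ := by
  refine hX.2.mono' ?_ (Filter.Eventually.of_forall fun ω => ?_)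
  · exact ((hX.1.pos hsa).measurable_comp (F := fun A : Mat d => A.trace.re)
      (by fun_prop)).aestronglyMeasurable
  · rw [Real.norm_of_nonneg (trace_re_nonneg (pos_nonneg _))]
    exact trace_re_mono (pos_le_abs (hsa ω))

/-- The positive part of a Hermitian fixed point of the transfer operator is a fixed point. -/
theorem transfer_pos_eq (hθ : MeasurePreserving θ μ μ) (hX : MemPredual μ X)
    (hsa : ∀ ω, IsSelfAdjoint (X ω)) (hfix : ∀ᵐ ω ∂μ, transfer θ φ X ω = X ω) :
    ∀ᵐ ω ∂μ, transfer θ φ (fun ω => pos (X ω)) ω = pos (X ω) := by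
  have hint := integrable_trace_pos hX hsa
  have hθ' : MeasurePreserving θ.symm μ μ := hθ.symm θ
  have hint' : Integrable (fun ω => (pos (X (θ.symm ω))).trace.re) μ :=
    hθ'.integrable_comp_of_integrable hint
  have hdecomp : ∀ᵐ ω ∂μ, X ω = φ ω (pos (X (θ.symm ω))) -
      φ ω (pos (X (θ.symm ω)) - X (θ.symm ω)) := by
    filter_upwards [hfix] with ω hω
    rw [map_sub, sub_sub_cancel]
    exact hω.symm
  have hB ω : 0 ≤ φ ω (pos (X (θ.symm ω))) := (φ ω).map_nonneg (pos_nonneg _)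
  have hD ω : 0 ≤ φ ω (pos (X (θ.symm ω)) - X (θ.symm ω)) :=
    (φ ω).map_nonneg (sub_nonneg.2 (le_pos (hsa _)))
  have hle : (fun ω => (pos (X ω)).trace.re) ≤ᵐ[μ] fun ω => (pos (X (θ.symm ω))).trace.re := by
    filter_upwards [hdecomp] with ω hω
    have hsum := trace_pos_add (hB ω) (hD ω) hω
    have hQ := posProj_isStarProjection (X ω)
    have h1 := trace_projection_mul_nonneg hQ (hD ω)
    have h2 := trace_projection_mul_nonneg hQ.one_sub (hB ω)
    rw [(φ ω).trace_map'] at hsum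
    linarith
  -- An almost sure inequality between functions with equal integrals is an equality.
  have heq := (integral_eq_iff_of_ae_le hint hint' hle).1
    (hθ'.integral_comp θ.symm.measurableEmbedding fun ω => (pos (X ω)).trace.re).symm
  filter_upwards [hdecomp, heq] with ω hω htr
  exact (pos_eq_of_trace_eq (hB ω) (hD ω) hω (htr.trans (by rw [(φ ω).trace_map']))).symm

/-- The positive spectral projection of a Hermitian fixed point reduces the system. -/
theorem reduces_posProj (hθ : MeasurePreserving θ μ μ) (hX : MemPredual μ X)
    (hsa : ∀ ω, IsSelfAdjoint (X ω)) (hfix : ∀ᵐ ω ∂μ, transfer θ φ X ω = X ω) :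
    Reduces μ θ φ fun ω => posProj (X ω) := by
  -- Adding `1` keeps the constant positive where `X⁺ = 0`.
  have hmeas : Measurable fun ω => ‖posPinv (X ω)‖ * (pos (X ω)).trace.re + 1 :=
    (((hX.1.posPinv hsa).measurable_comp (F := fun A : Mat d => ‖A‖) continuous_norm).mul
      ((hX.1.pos hsa).measurable_comp (F := fun A : Mat d => A.trace.re)
        (by fun_prop))).add_const 1
  refine ⟨_, hmeas, Filter.Eventually.of_forall fun ω => ?_, fun N _ => ?_⟩
  · have := trace_re_nonneg (pos_nonneg (X ω))
    positivity
  filter_upwards [forward_eq_of_transfer_eq hθ (transfer_pos_eq hθ hX hsa hfix)] with ω hω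
  -- This is what makes the constant independent of `N`.
  have htr : (pos (X (θ^[N] ω))).trace.re = (pos (X ω)).trace.re := by
    rw [← hω N, trace_forward]
  calc forward θ φ N ω (posProj (X ω))
      ≤ forward θ φ N ω (‖posPinv (X ω)‖ • pos (X ω)) := forward_mono N ω (posProj_le (hsa ω))
    _ = ‖posPinv (X ω)‖ • pos (X (θ^[N] ω)) := by rw [forward_smul, hω N]
    _ ≤ ‖posPinv (X ω)‖ • ((pos (X ω)).trace.re • posProj (X (θ^[N] ω))) :=
        smul_le_smul_of_nonneg_left (htr ▸ pos_le (hsa _)) (norm_nonneg _)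
    _ = (‖posPinv (X ω)‖ * (pos (X ω)).trace.re) • posProj (X (θ^[N] ω)) := smul_smul _ _ _
    _ ≤ _ := smul_le_smul_of_nonneg_right (by linarith) (posProj_isStarProjection _).nonneg

/-- The positive spectral projection of a Hermitian fixed point in the corner of a minimal
reducing projection `P` is either zero or `P`. -/
theorem posProj_eq_zero_or_eq (hθ : MeasurePreserving θ μ μ) (hP : IsMinimalReducing μ θ φ P)
    (hX : MemCornerPredual μ P X) (hsa : ∀ ω, IsSelfAdjoint (X ω))
    (hfix : ∀ᵐ ω ∂μ, transfer θ φ X ω = X ω) :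
    (∀ᵐ ω ∂μ, posProj (X ω) = 0) ∨ ∀ᵐ ω ∂μ, posProj (X ω) = P ω := by
  refine or_iff_not_imp_left.2 fun hne => hP.2 _ ⟨⟨hX.1.1.posProj hsa, ?_⟩,
    reduces_posProj hθ hX.1 hsa hfix, hne⟩ ?_
  · exact Filter.Eventually.of_forall fun ω => posProj_isStarProjection _
  · filter_upwards [hP.1.1.2, hX.2] with ω hPω hXω
    rw [(posProj_isStarProjection _).le_iff_mul_eq_right hPω, ← mul_posPinv (hsa ω), ← mul_assoc]
    congr 1
    rw [← hXω, ← mul_assoc, ← mul_assoc, hPω.isIdempotentElem.eq]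

theorem nonneg_or_neg_nonneg (hθ : MeasurePreserving θ μ μ) (hP : IsMinimalReducing μ θ φ P)
    (hX : MemCornerPredual μ P X) (hsa : ∀ ω, IsSelfAdjoint (X ω))
    (hfix : ∀ᵐ ω ∂μ, transfer θ φ X ω = X ω) :
    (∀ᵐ ω ∂μ, 0 ≤ X ω) ∨ ∀ᵐ ω ∂μ, 0 ≤ -X ω := by
  have hneg : MemCornerPredual μ P fun ω => -X ω := by
    refine ⟨⟨fun i j => (hX.1.1 i j).neg, ?_⟩, ?_⟩
    · simpa only [traceNorm, CFC.abs_neg] using hX.1.2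
    · filter_upwards [hX.2] with ω hω
      rw [mul_neg, neg_mul, hω]
  have hfixneg : ∀ᵐ ω ∂μ, transfer θ φ (fun ω => -X ω) ω = -X ω := by
    filter_upwards [hfix] with ω hω
    rw [← hω, transfer, map_neg, transfer]
  rcases posProj_eq_zero_or_eq hθ hP hX hsa hfix with h | h
  · right
    filter_upwards [h] with ω hω
    exact neg_nonneg_of_posProj_eq_zero (hsa ω) hω
  rcases posProj_eq_zero_or_eq hθ hP hneg (fun ω => (hsa ω).neg) hfixneg with h' | h'
  · left
    filter_upwards [h'] with ω hω
    simpa using neg_nonneg_of_posProj_eq_zero (hsa ω).neg hω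
  -- If both supports equal `P`, then `P = P * P` is a product of orthogonal projections, hence
  -- zero.
  · refine absurd ?_ hP.1.2.2
    filter_upwards [h, h', hP.1.1.2] with ω h1 h2 hPω
    rw [← hPω.isIdempotentElem.eq]
    nth_rw 1 [← h1]
    rw [← h2, posProj_mul_posProj_neg (hsa ω)]

end ERIS

theorem mainTheorem5 {Ω : Type*} [MeasurableSpace Ω] (μ : Measure Ω) [IsProbabilityMeasure μ]
    (d : ℕ) (θ : Ω ≃ᵐ Ω) (hθ : Ergodic θ μ)
    (φ : Ω → ERIS.QuantumChannel d) (hφ : ERIS.IsRandomChannel φ)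
    (P : Ω → ERIS.Mat d) (hP : ERIS.IsMinimalReducing μ θ φ P)
    (X : Ω → ERIS.Mat d) (hX : ERIS.MemCornerPredual μ P X)
    (hsa : ∀ᵐ ω ∂μ, IsSelfAdjoint (X ω))
    (hfix : ∀ᵐ ω ∂μ, ERIS.transfer θ φ X ω = X ω) :
    (∀ᵐ ω ∂μ, 0 ≤ X ω) ∨ (∀ᵐ ω ∂μ, 0 ≤ -X ω) := by
  have hθ' : MeasurePreserving θ.symm μ μ := hθ.toMeasurePreserving.symm θ
  -- A version of `X` that is self-adjoint everywhere, as the measurability lemmas require.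
  let Y : Ω → ERIS.Mat d := fun ω => (2⁻¹ : ℝ) • (X ω + star (X ω))
  have hYX : ∀ᵐ ω ∂μ, Y ω = X ω := hsa.mono fun ω => ERIS.symmetrize_of_isSelfAdjoint
  have hYsa (ω : Ω) : IsSelfAdjoint (Y ω) :=
    (IsSelfAdjoint.all (2⁻¹ : ℝ)).smul (IsSelfAdjoint.add_star_self (X ω))
  have hYm : ERIS.IsRandomMatrix Y := fun i j =>
    hX.1.1.measurable_comp (F := fun A : ERIS.Mat d => ((2⁻¹ : ℝ) • (A + star A)) i j)
      (Continuous.matrix_elem (by fun_prop) i j)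
  have hY : ERIS.MemCornerPredual μ P Y := by
    refine ⟨⟨hYm, hX.1.2.congr (hYX.mono fun ω h => congrArg ERIS.traceNorm h.symm)⟩, ?_⟩
    filter_upwards [hYX, hX.2] with ω h1 h2
    rw [h1, h2]
  have hYfix : ∀ᵐ ω ∂μ, ERIS.transfer θ φ Y ω = Y ω := by
    filter_upwards [hYX, hfix, hθ'.quasiMeasurePreserving.ae hYX] with ω h1 h2 h3
    rw [h1, ← h2, ERIS.transfer, ERIS.transfer, h3]
  refine (ERIS.nonneg_or_neg_nonneg hθ.toMeasurePreserving hP hY hYsa hYfix).imp ?_ ?_ <;>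
  · intro h
    filter_upwards [h, hYX] with ω h1 h2
    rwa [← h2]
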